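/- All Banach spaces are real. For a set $L$, let $\ell_\infty(L)$ be the space of bounded real families on $L$ and $c_0(L)\subseteq\ell_\infty(L)$ the subspace of families $x$ such that $\{t\in L:|x_t|\ge\varepsilon\}$ is finite for every $\varepsilon>0$, both with the supremum norm. Let $$U(L)=\bigl\{(f,x)\in\ell_\infty(L)\oplus c_0(L):\ \|f\|_\infty<\bigl\||f|+\tfrac12|x|\bigr\|_\infty\ \text{ and }\ \|x\|_\infty<\bigl\||f|+\tfrac12|x|\bigr\|_\infty\bigr\}.$$ For $k\in\mathbb N\cup\{\infty\}$, a norm on a Banach space $Y$ is said to be of class $C^k$ if it is of class $C^k$ in the Fréchet sense as a function on $Y\setminus\{0\}$. For Banach spaces $X$ and $E$, the injective tensor product $X\otimes_\varepsilon E$ is the completion of the algebraic tensor product $X\odot E$ for the norm $$\|z\|_\varepsilon=\sup\{|(\xi\otimes\eta)(z)|:\ \xi\in X^*,\ \|\xi\|\le1,\ \eta\in E^*,\ \|\eta\|\le1\}.$$ **Corollary 1.** Let $X$ be a Banach space and let $L$ be a set. Suppose that there exist a linear homeomorphic embedding $S:X\to\ell_\infty(L)$ and a bounded linear operator $T:X\to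 c_0(L)$ such that $(Sx,Tx)\in U(L)$ for every non-zero $x\in X$. Then $X$ admits an equivalent norm of class $C^\infty$. Moreover, for every $k\in\mathbb N\cup\{\infty\}$ and every Banach space $E$ that admits an equivalent norm of class $C^k$, the injective tensor product $X\otimes_\varepsilon E$ admits an equivalent norm of class $C^k$. -/

import Mathlib

open scoped ENNReal TensorProduct

noncomputable section

/-- The Banach space `ℓ_∞(L)` of bounded real families indexed by `L`, with the sup norm. -/
abbrev LInfty (L : Type*) : Type _ := lp (fun _ : L => ℝ) ∞

/-- The subspace `c₀(L)` of `ℓ_∞(L)`: the families that tend to `0` along the cofinite filter,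
with the sup norm. -/
def cZero (L : Type*) : Submodule ℝ (LInfty L) where
  carrier := {x | Filter.Tendsto (fun t => x t) Filter.cofinite (nhds 0)}
  add_mem' := by
    intro a b ha hb
    simpa using Filter.Tendsto.add ha hb
  zero_mem' := by
    simpa using (tendsto_const_nhds : Filter.Tendsto (fun _ : L => (0 : ℝ)) Filter.cofinite _)
  smul_mem' := by
    intro c a ha
    simpa using Filter.Tendsto.const_mul c ha

/-- The set `U(L)` of pairs `(f, x)` in `ℓ_∞(L) ⊕ c₀(L)` such that `‖f‖_∞` and `‖x‖_∞` are both
strictly less than `‖|f| + |x| / 2‖_∞`. The family `|f| + |x| / 2` is nonnegative and bounded, so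
that its sup norm is its supremum. -/
def haydonSet (L : Type*) : Set (LInfty L × cZero L) :=
  {p | ‖p.1‖ < ⨆ t : L, (|p.1 t| + (1 / 2 : ℝ) * |(p.2 : LInfty L) t|) ∧
       ‖p.2‖ < ⨆ t : L, (|p.1 t| + (1 / 2 : ℝ) * |(p.2 : LInfty L) t|)}

/-- `X` admits an equivalent norm of class `C^k` (on the complement of the origin). The lower
bound makes the seminorm `N` a norm. -/
def HasEquivSmoothNorm (X : Type*) [NormedAddCommGroup X] [NormedSpace ℝ X] (k : ℕ∞) : Prop :=
  ∃ N : Seminorm ℝ X,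
    (∃ c > 0, ∃ C > 0, ∀ x : X, c * ‖x‖ ≤ N x ∧ N x ≤ C * ‖x‖) ∧
    ContDiffOn ℝ (k : WithTop ℕ∞) (fun x : X => N x) {x | x ≠ 0}

section InjectiveTensorProduct

variable (X E : Type*) [NormedAddCommGroup X] [NormedSpace ℝ X]
  [NormedAddCommGroup E] [NormedSpace ℝ E]

/-- The algebraic tensor product `X ⊙ E`, as a type that is to carry the injective norm. -/
def AlgTensor : Type _ := X ⊗[ℝ] E

instance : AddCommGroup (AlgTensor X E) := inferInstanceAs (AddCommGroup (X ⊗[ℝ] E))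

instance : Module ℝ (AlgTensor X E) := inferInstanceAs (Module ℝ (X ⊗[ℝ] E))

variable {X E}

/-- The linear form `ξ ⊗ η` on `X ⊙ E`, with `(ξ ⊗ η) (x ⊗ e) = ξ x * η e`. -/
def tensorForm (ξ : StrongDual ℝ X) (η : StrongDual ℝ E) : AlgTensor X E →ₗ[ℝ] ℝ :=
  TensorProduct.dualDistrib ℝ X E
    ((ξ : X →ₗ[ℝ] ℝ) ⊗ₜ[ℝ] (η : E →ₗ[ℝ] ℝ))

theorem tensorForm_tmul (ξ : StrongDual ℝ X) (η : StrongDual ℝ E) (x : X) (e : E) :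
    tensorForm ξ η (x ⊗ₜ[ℝ] e : X ⊗[ℝ] E) = ξ x * η e := rfl

variable (X E) in
/-- Pairs in `ball X* × ball E*` (closed unit balls). -/
abbrev DualBalls : Type _ :=
  Metric.closedBall (0 : StrongDual ℝ X) 1 × Metric.closedBall (0 : StrongDual ℝ E) 1

instance : Nonempty (DualBalls X E) :=
  ⟨(⟨0, Metric.mem_closedBall_self zero_le_one⟩, ⟨0, Metric.mem_closedBall_self zero_le_one⟩)⟩

/-- `‖z‖_ε`, the supremum of `|(ξ ⊗ η) z|` over `ξ ∈ ball X*`, `η ∈ ball E*`. -/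
def injNorm (z : AlgTensor X E) : ℝ :=
  ⨆ p : DualBalls X E, |tensorForm p.1.1 p.2.1 z|

theorem injNorm_bddAbove (z : AlgTensor X E) :
    BddAbove (Set.range fun p : DualBalls X E => |tensorForm p.1.1 p.2.1 z|) := by
  induction z using TensorProduct.induction_on with
  | zero =>
    refine ⟨0, ?_⟩
    rintro _ ⟨p, rfl⟩
    exact (abs_eq_zero.2 (map_zero (tensorForm p.1.1 p.2.1))).le
  | tmul x e =>
    refine ⟨‖x‖ * ‖e‖, ?_⟩
    rintro _ ⟨p, rfl⟩
    have h1 : ‖p.1.1‖ ≤ 1 := mem_closedBall_zero_iff.1 p.1.2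
    have h2 : ‖p.2.1‖ ≤ 1 := mem_closedBall_zero_iff.1 p.2.2
    have h3 : |p.1.1 x| ≤ ‖x‖ := by simpa using p.1.1.le_of_opNorm_le h1 x
    have h4 : |p.2.1 e| ≤ ‖e‖ := by simpa using p.2.1.le_of_opNorm_le h2 e
    change |p.1.1 x * p.2.1 e| ≤ _
    rw [abs_mul]
    exact mul_le_mul h3 h4 (abs_nonneg _) (norm_nonneg _)
  | add a b ha hb =>
    obtain ⟨A, hA⟩ := ha
    obtain ⟨B, hB⟩ := hb
    refine ⟨A + B, ?_⟩
    rintro _ ⟨p, rfl⟩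
    have h := map_add (tensorForm p.1.1 p.2.1) (a : AlgTensor X E) (b : AlgTensor X E)
    exact (congrArg abs h).le.trans
      ((abs_add_le _ _).trans (add_le_add (hA ⟨p, rfl⟩) (hB ⟨p, rfl⟩)))

variable (X E) in
/-- The injective norm, with the seminorm axioms. -/
def injSeminorm : Seminorm ℝ (AlgTensor X E) :=
  Seminorm.of injNorm
    (fun a b => ciSup_le fun p => by
      rw [map_add]
      exact (abs_add_le _ _).trans
        (add_le_add (le_ciSup (injNorm_bddAbove a) p) (le_ciSup (injNorm_bddAbove b) p)))
    (fun r a => by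
      simp only [injNorm, map_smul, smul_eq_mul, abs_mul, Real.norm_eq_abs]
      exact (Real.mul_iSup_of_nonneg (abs_nonneg r) _).symm)

instance : SeminormedAddCommGroup (AlgTensor X E) :=
  (injSeminorm X E).toAddGroupSeminorm.toSeminormedAddCommGroup

theorem AlgTensor.norm_def (z : AlgTensor X E) :
    ‖z‖ = ⨆ p : DualBalls X E, |tensorForm p.1.1 p.2.1 z| := rfl

instance : NormedSpace ℝ (AlgTensor X E) where
  norm_smul_le r z := (map_smul_eq_mul (injSeminorm X E) r z).le

variable (X E) in
/-- The injective tensor product `X ⊗_ε E`: the completion of `X ⊙ E` for the injective norm. -/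
abbrev InjectiveTensor : Type _ := UniformSpace.Completion (AlgTensor X E)

end InjectiveTensorProduct

end

/-! The new unit ball is `{Θ < 1}` for an even, convex, `C^k` function `Θ` on an open convex region.
It is built from seminorms `A t`, `B t`, each smooth off its kernel, with `B t z → 0` along the
index set. In `X` they are `|S x t|` and `|T x t|`; in the tensor product they are `N` of the slices
of `z` by the coordinate functionals of `S` and `T`, where `N` is the smooth norm of `E`.

`Θ` (`haydonSum`) adds smooth ramps that vanish unless `A t + w B t > 1`, with weights `w`
decreasing from `1` to `1/2`. On the region, `A t + B t / 2` and `B t` stay uniformly below `1`.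
Hence only finitely many terms are active near a point: `B t` is small for all but finitely many
`t`, and for those `t` the weights approach `1/2`. An active term has `A t` and `B t` both non-zero,
so it is smooth (`contDiffAt_haydonSum`).

Haydon's strict inequalities make `A t + B t / 2` the first constraint of the region to be violated
along a ray, at an index with `B t > 0`. A weight slightly above `1/2` then drives `Θ` up to `1`
before the ray leaves the region (`exists_haydonSum_eq_one`), and the implicit function theorem
makes the gauge smooth.

The inequalities pass to the tensor product by duality. The supremum of `N` over the slices of `z`
is `‖S x‖` for some right slice `x = (id ⊗ η) z`, because `η` ranges over a weak-* compact ball on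
which the right slice is norm continuous (`exists_isMaxOn_weakDualBall`). The hypothesis applies to
that one vector of `X`, so strictness survives. -/

/-! ### Smooth gauges of convex sublevel sets -/

theorem gauge_eq_inv_of_convexOn {Z : Type*} [AddCommGroup Z] [Module ℝ Z]
    {Ω : Set Z} (hΩ : Convex ℝ Ω) (h0 : (0 : Z) ∈ Ω) {Θ : Z → ℝ} (hΘ : ConvexOn ℝ Ω Θ)
    (hΘ0 : Θ 0 = 0) {z : Z} {r : ℝ} (hr : 0 < r)
    (hz : r • z ∈ Ω) (h1 : Θ (r • z) = 1) : gauge {z | z ∈ Ω ∧ Θ z < 1} z = r⁻¹ := by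
  have scale : ∀ (w : Z) (s : ℝ), w ∈ Ω → 0 ≤ s → s ≤ 1 → s • w ∈ Ω ∧ Θ (s • w) ≤ s * Θ w := by
    intro w s hw hs0 hs1
    refine ⟨hΩ.smul_mem_of_zero_mem h0 hw ⟨hs0, hs1⟩, ?_⟩
    have := hΘ.2 hw h0 hs0 (sub_nonneg.2 hs1) (by ring)
    simpa [hΘ0] using this
  have hset : ∀ s : ℝ, 0 < s → (s • z ∈ {z | z ∈ Ω ∧ Θ z < 1} ↔ s < r) := by
    intro s hs
    constructor
    · rintro ⟨hsΩ, hs1⟩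
      by_contra! hle
      have := (scale (s • z) (r / s) hsΩ (by positivity) ((div_le_one hs).2 hle)).2
      rw [smul_smul, div_mul_cancel₀ _ hs.ne', h1] at this
      have h2 : r / s ≤ 1 := (div_le_one hs).2 hle
      have h3 : 0 < r / s := by positivity
      nlinarith
    · intro hlt
      have h2 : s / r < 1 := (div_lt_one hr).2 hlt
      have := scale (r • z) (s / r) hz (by positivity) h2.le
      rw [smul_smul, div_mul_cancel₀ _ hr.ne', h1, mul_one] at this
      exact ⟨this.1, this.2.trans_lt h2⟩
  rw [gauge_def']
  have : {q ∈ Set.Ioi (0 : ℝ) | q⁻¹ • z ∈ {z | z ∈ Ω ∧ Θ z < 1}} = Set.Ioi r⁻¹ := by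
    ext q
    constructor
    · rintro ⟨hq, h⟩
      exact inv_lt_of_inv_lt₀ hq ((hset q⁻¹ (inv_pos.2 hq)).1 h)
    · intro hq
      have hq0 : 0 < q := (inv_pos.2 hr).trans hq
      exact ⟨hq0, (hset q⁻¹ (inv_pos.2 hq0)).2 (inv_lt_of_inv_lt₀ hr hq)⟩
  rw [this, csInf_Ioi]

/-- The reciprocal of the gauge solves `Θ (ψ w • w) = 1`. The implicit function theorem applies
because convexity makes the radial derivative positive where `Θ = 1`. -/
theorem contDiffAt_gauge_of_convexOn {Z : Type*} [NormedAddCommGroup Z] [NormedSpace ℝ Z]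
    [CompleteSpace Z] {n : WithTop ℕ∞} (hn : n ≠ 0) {Ω : Set Z} (hΩo : IsOpen Ω)
    (hΩ : Convex ℝ Ω) (h0 : (0 : Z) ∈ Ω) {Θ : Z → ℝ} (hΘ : ConvexOn ℝ Ω Θ) (hΘ0 : Θ 0 = 0)
    {z : Z} {r : ℝ} (hr : 0 < r)
    (hz : r • z ∈ Ω) (h1 : Θ (r • z) = 1) (hsm : ContDiffAt ℝ n Θ (r • z)) :
    ContDiffAt ℝ n (gauge {z | z ∈ Ω ∧ Θ z < 1}) z := by
  set f : Z × ℝ → ℝ := fun p => Θ (p.2 • p.1) with hf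
  have hg : ContDiff ℝ n (fun p : Z × ℝ => p.2 • p.1) := contDiff_snd.smul contDiff_fst
  have cdf : ContDiffAt ℝ n f (z, r) :=
    ContDiffAt.comp (f := fun p : Z × ℝ => p.2 • p.1) (g := Θ) (z, r) hsm hg.contDiffAt
  have hfd : HasFDerivAt f (fderiv ℝ f (z, r)) (z, r) :=
    (cdf.differentiableAt hn).hasFDerivAt
  have hline : HasDerivAt (fun s : ℝ => f (z, s))
      ((fderiv ℝ f (z, r) ∘L .inr ℝ Z ℝ) 1) r := by
    have h2 : HasDerivAt (fun s : ℝ => (z, s)) ((0 : Z), (1 : ℝ)) r :=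
      (hasDerivAt_const r z).prodMk (hasDerivAt_id r)
    exact hfd.comp_hasDerivAt r h2
  have hpos : 0 < (fderiv ℝ f (z, r) ∘L .inr ℝ Z ℝ) 1 := by
    have hc : ConvexOn ℝ ((LinearMap.toSpanSingleton ℝ Z z) ⁻¹' Ω)
        (Θ ∘ (LinearMap.toSpanSingleton ℝ Z z)) := hΘ.comp_linearMap _
    have h3 := hc.slope_le_of_hasDerivAt (x := 0) (y := r) (by simpa using h0)
      (by simpa using hz) hr hline
    have h4 : slope (Θ ∘ (LinearMap.toSpanSingleton ℝ Z z)) 0 r = r⁻¹ := by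
      simp [slope_def_field, h1, hΘ0]
    rw [h4] at h3
    exact (inv_pos.2 hr).trans_le h3
  have hinv : (fderiv ℝ f (z, r) ∘L .inr ℝ Z ℝ).IsInvertible := by
    set ℓ := (fderiv ℝ f (z, r) ∘L .inr ℝ Z ℝ)
    refine ⟨ContinuousLinearEquiv.unitsEquivAut ℝ (Units.mk0 (ℓ 1) hpos.ne'), ?_⟩
    ext
    simp
  have hψ := cdf.contDiffAt_implicitFunction hn hinv
  have hψ0 := cdf.implicitFunction_apply_self hn hinv
  have hev := cdf.eventually_apply_implicitFunction hn hinv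
  set ψ := cdf.implicitFunction hn hinv
  simp only at hψ hψ0 hev
  have hψr : 0 < ψ z := hψ0 ▸ hr
  have hc : ContinuousAt (fun w => ψ w • w) z := hψ.continuousAt.smul continuousAt_id
  have e1 : ∀ᶠ w in nhds z, 0 < ψ w := hψ.continuousAt.eventually (lt_mem_nhds hψr)
  have e2 : ∀ᶠ w in nhds z, ψ w • w ∈ Ω :=
    hc.eventually (hΩo.mem_nhds (by simpa [hψ0] using hz))
  have : ContDiffAt ℝ n (fun w => (ψ w)⁻¹) z := hψ.inv hψr.ne'
  refine this.congr_of_eventuallyEq ?_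
  filter_upwards [hev, e1, e2] with w hw1 hw2 hw3
  exact gauge_eq_inv_of_convexOn hΩ h0 hΘ hΘ0 hw2 hw3 (by simpa [hf, h1] using hw1)

theorem hasEquivSmoothNorm_of_convexOn {Z : Type*} [NormedAddCommGroup Z] [NormedSpace ℝ Z]
    [CompleteSpace Z] {k : ℕ∞} (hk : k ≠ 0) {Ω : Set Z} (hΩo : IsOpen Ω)
    (hΩ : Convex ℝ Ω) (h0 : (0 : Z) ∈ Ω) (hneg : ∀ z ∈ Ω, -z ∈ Ω) {R : ℝ} (hR0 : 0 < R)
    (hR : ∀ z ∈ Ω, ‖z‖ ≤ R) {Θ : Z → ℝ} (hΘ : ConvexOn ℝ Ω Θ) (hΘ0 : Θ 0 = 0)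
    (heven : ∀ z, Θ (-z) = Θ z) (hsm : ∀ z ∈ Ω, ContDiffAt ℝ k Θ z)
    (hhit : ∀ z : Z, z ≠ 0 → ∃ r : ℝ, 0 < r ∧ r • z ∈ Ω ∧ Θ (r • z) = 1) :
    HasEquivSmoothNorm Z k := by
  set B : Set Z := {z | z ∈ Ω ∧ Θ z < 1} with hB
  have hBo : IsOpen B := by
    have : ContinuousOn Θ Ω := fun z hz => (hsm z hz).continuousAt.continuousWithinAt
    exact this.isOpen_inter_preimage hΩo isOpen_Iio
  have hBn : B ∈ nhds (0 : Z) := hBo.mem_nhds ⟨h0, by simp [hΘ0]⟩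
  have hBc : Convex ℝ B := hΘ.convex_lt 1
  have habs : Absorbent ℝ B := absorbent_nhds_zero hBn
  have hbal : Balanced ℝ B := by
    rw [balanced_iff_neg_mem hBc]
    exact fun z hz => ⟨hneg z hz.1, by rw [heven]; exact hz.2⟩
  obtain ⟨ρ, hρ, hρB⟩ := Metric.mem_nhds_iff.1 hBn
  refine ⟨gaugeSeminorm hbal hBc habs, ⟨R⁻¹, inv_pos.2 hR0, ρ⁻¹, inv_pos.2 hρ, fun z => ⟨?_, ?_⟩⟩,
    fun z hz => ?_⟩
  · have := le_gauge_of_subset_closedBall (x := z) habs hR0.le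
      (fun w hw => mem_closedBall_zero_iff.2 (hR w hw.1))
    rw [inv_mul_eq_div]
    exact this
  · have := mul_gauge_le_norm (x := z) hρB
    rw [inv_mul_eq_div, le_div_iff₀' hρ]
    exact this
  · obtain ⟨r, hr, hrz, h1⟩ := hhit z hz
    exact (contDiffAt_gauge_of_convexOn (by exact_mod_cast hk) hΩo hΩ h0 hΘ hΘ0 hr hrz h1
      (hsm _ hrz)).contDiffWithinAt

/-- A normalised primitive of `expNegInvGlue` works: its derivative is smooth, nonnegative and
increasing. -/
theorem exists_smooth_convex_ramp : ∃ h : ℝ → ℝ, ContDiff ℝ (⊤ : ℕ∞) h ∧ ConvexOn ℝ Set.univ h ∧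
    Monotone h ∧ (∀ x ≤ 0, h x = 0) ∧ h 1 = 1 := by
  set g : ℝ → ℝ := fun x => ∫ t in (0 : ℝ)..x, expNegInvGlue t
  have hcont : Continuous expNegInvGlue := (expNegInvGlue.contDiff (n := 0)).continuous
  have hd : ∀ x, HasDerivAt g (expNegInvGlue x) x := fun x =>
    intervalIntegral.integral_hasDerivAt_right (hcont.intervalIntegrable _ _)
      hcont.aestronglyMeasurable.stronglyMeasurableAtFilter hcont.continuousAt
  have hderiv : deriv g = expNegInvGlue := funext fun x => (hd x).deriv
  have hdiff : Differentiable ℝ g := fun x => (hd x).differentiableAt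
  have h1 : 0 < g 1 := intervalIntegral.intervalIntegral_pos_of_pos_on
    (hcont.intervalIntegrable _ _) (fun x hx => expNegInvGlue.pos_of_pos hx.1) one_pos
  have hg : ContDiff ℝ (⊤ : ℕ∞) g := by
    rw [contDiff_infty_iff_deriv, hderiv]
    exact ⟨hdiff, expNegInvGlue.contDiff⟩
  have hmono : Monotone g := monotone_of_deriv_nonneg hdiff (by
    rw [hderiv]; exact expNegInvGlue.nonneg)
  have hconv : ConvexOn ℝ Set.univ g := Monotone.convexOn_univ_of_deriv hdiff (by
    rw [hderiv]; exact expNegInvGlue.monotone)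
  have hzero : ∀ x ≤ 0, g x = 0 := by
    intro x hx
    have : ∀ t ∈ Set.uIcc 0 x, expNegInvGlue t = 0 := by
      intro t ht
      rw [Set.uIcc_of_ge hx] at ht
      exact expNegInvGlue.zero_of_nonpos ht.2
    calc g x = ∫ t in (0 : ℝ)..x, (0 : ℝ) := intervalIntegral.integral_congr this
      _ = 0 := by simp
  refine ⟨fun x => (g 1)⁻¹ * g x, contDiff_const.mul hg, ?_, ?_, ?_, ?_⟩
  · exact hconv.smul (inv_pos.2 h1).le
  · exact hmono.const_mul (inv_pos.2 h1).le
  · intro x hx; simp [hzero x hx]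
  · exact inv_mul_cancel₀ h1.ne'

/-! ### The locally finite sum of ramps -/

section

variable {Z L : Type*} [NormedAddCommGroup Z] [NormedSpace ℝ Z]

/-- The region on which the families `A t z + B t z / 2` and `B t z` are bounded away from `1`. -/
def subunitRegion (A B : L → Seminorm ℝ Z) : Set Z :=
  {z | ∃ m < 1, ∀ t, A t z + 1 / 2 * B t z ≤ m ∧ B t z ≤ m}

/-- The weights `1 / 2 + 2 ^ (-n - 1)`, decreasing from `1` to `1 / 2`. -/
noncomputable def haydonWeight (n : ℕ) : ℝ := 1 / 2 + (1 / 2) * (1 / 2) ^ n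

/-- The sum over `(n, t)` of smooth convex ramps of `A t z + haydonWeight n * B t z`. -/
noncomputable def haydonSum (h : ℝ → ℝ) (A B : L → Seminorm ℝ Z) (z : Z) : ℝ :=
  ∑' p : ℕ × L, h (4 ^ p.1 * (A p.2 z + haydonWeight p.1 * B p.2 z - 1))

theorem haydonWeight_pos (n : ℕ) : 0 < haydonWeight n := by unfold haydonWeight; positivity

theorem haydonWeight_le_one (n : ℕ) : haydonWeight n ≤ 1 := by
  unfold haydonWeight
  have : (1 / 2 : ℝ) ^ n ≤ 1 := pow_le_one₀ (by norm_num) (by norm_num)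
  linarith

theorem isOpen_subunitRegion {A B : L → Seminorm ℝ Z} {K : ℝ} (hK : 0 ≤ K)
    (hA : ∀ t z, A t z ≤ K * ‖z‖) (hB : ∀ t z, B t z ≤ K * ‖z‖) :
    IsOpen (subunitRegion A B) := by
  rw [Metric.isOpen_iff]
  rintro z ⟨m, hm, hz⟩
  refine ⟨(1 - m) / (4 * (K + 1)), by have := sub_pos.2 hm; positivity, fun w hw => ?_⟩
  rw [Metric.mem_ball, dist_eq_norm, lt_div_iff₀ (by positivity)] at hw
  have hKw : K * ‖w - z‖ ≤ (1 - m) / 4 := by nlinarith [norm_nonneg (w - z)]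
  refine ⟨(1 + m) / 2, by linarith, fun t => ?_⟩
  have h1 : A t w ≤ A t z + A t (w - z) := by simpa using map_add_le_add (A t) z (w - z)
  have h2 : B t w ≤ B t z + B t (w - z) := by simpa using map_add_le_add (B t) z (w - z)
  have := hA t (w - z)
  have := hB t (w - z)
  have := hz t
  constructor <;> linarith

theorem convex_subunitRegion (A B : L → Seminorm ℝ Z) : Convex ℝ (subunitRegion A B) := by
  rintro x ⟨m, hm, hx⟩ y ⟨m', hm', hy⟩ a b ha hb hab
  refine ⟨max m m', max_lt hm hm', fun t => ?_⟩
  have h1 : A t (a • x + b • y) ≤ a * A t x + b * A t y :=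
    (map_add_le_add (A t) _ _).trans_eq (by simp [map_smul_eq_mul, abs_of_nonneg, ha, hb])
  have h2 : B t (a • x + b • y) ≤ a * B t x + b * B t y :=
    (map_add_le_add (B t) _ _).trans_eq (by simp [map_smul_eq_mul, abs_of_nonneg, ha, hb])
  have e1 := le_max_left m m'
  have e2 := le_max_right m m'
  have k1 : a * (A t x + 1 / 2 * B t x) ≤ a * max m m' :=
    mul_le_mul_of_nonneg_left ((hx t).1.trans e1) ha
  have k2 : b * (A t y + 1 / 2 * B t y) ≤ b * max m m' :=
    mul_le_mul_of_nonneg_left ((hy t).1.trans e2) hb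
  have k3 : a * B t x ≤ a * max m m' := mul_le_mul_of_nonneg_left ((hx t).2.trans e1) ha
  have k4 : b * B t y ≤ b * max m m' := mul_le_mul_of_nonneg_left ((hy t).2.trans e2) hb
  have k5 : a * max m m' + b * max m m' = max m m' := by rw [← add_mul, hab, one_mul]
  constructor <;> linarith

theorem exists_finset_forall_notMem_lt_one {A B : L → Seminorm ℝ Z} {K : ℝ} (hK : 0 ≤ K)
    (hA : ∀ t z, A t z ≤ K * ‖z‖) (hB : ∀ t z, B t z ≤ K * ‖z‖)
    (hB0 : ∀ z, Filter.Tendsto (fun t => B t z) Filter.cofinite (nhds 0))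
    {z : Z} (hz : z ∈ subunitRegion A B) :
    ∃ s : Finset (ℕ × L), ∀ᶠ w in nhds z, ∀ p ∉ s, A p.2 w + haydonWeight p.1 * B p.2 w ≤ 1 := by
  obtain ⟨m, hm, hz⟩ := hz
  have hη : 0 < 1 - m := sub_pos.2 hm
  have hfin : {t | ¬ B t z < (1 - m) / 4}.Finite :=
    (hB0 z).eventually (gt_mem_nhds (by positivity))
  obtain ⟨n₀, hn₀⟩ := exists_pow_lt_of_lt_one (show 0 < (1 - m) / 4 by positivity)
    (show (1 / 2 : ℝ) < 1 by norm_num)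
  -- Off this set either `B t z` is so small that even weight `1` keeps the sum below `1`, or the
  -- weight is so close to `1/2` that the bound on `A t + B t / 2` suffices.
  refine ⟨Finset.range n₀ ×ˢ hfin.toFinset, ?_⟩
  filter_upwards [Metric.ball_mem_nhds z (ε := (1 - m) / (8 * (K + 1))) (by positivity)] with w hw
  rw [Metric.mem_ball, dist_eq_norm, lt_div_iff₀ (by positivity)] at hw
  have hKw : K * ‖w - z‖ ≤ (1 - m) / 8 := by nlinarith [norm_nonneg (w - z)]
  rintro ⟨n, t⟩ hp
  dsimp only
  have h1 : A t w ≤ A t z + A t (w - z) := by simpa using map_add_le_add (A t) z (w - z)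
  have h2 : B t w ≤ B t z + B t (w - z) := by simpa using map_add_le_add (B t) z (w - z)
  have h3 := hA t (w - z)
  have h4 := hB t (w - z)
  obtain ⟨h5, h6⟩ := hz t
  have hBw : 0 ≤ B t w := apply_nonneg _ _
  by_cases ht : B t z < (1 - m) / 4
  · have : haydonWeight n * B t w ≤ B t w := mul_le_of_le_one_left hBw (haydonWeight_le_one n)
    linarith
  · have hn : n₀ ≤ n := by
      by_contra! h
      exact hp (by simp [h]; simpa using ht)
    have hpow : (1 / 2 : ℝ) ^ n ≤ (1 - m) / 4 :=
      (pow_le_pow_of_le_one (by norm_num) (by norm_num) hn).trans hn₀.le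
    have : (1 / 2 : ℝ) ^ n * B t w ≤ (1 - m) / 4 * 2 := by
      apply mul_le_mul hpow _ hBw (by positivity)
      have : 0 ≤ A t z := apply_nonneg _ _
      have : 0 ≤ B t z := apply_nonneg _ _
      linarith
    unfold haydonWeight
    linarith

variable {h : ℝ → ℝ} (hzero : ∀ x ≤ 0, h x = 0) {A B : L → Seminorm ℝ Z} {K : ℝ} (hK : 0 ≤ K)
    (hA : ∀ t z, A t z ≤ K * ‖z‖) (hB : ∀ t z, B t z ≤ K * ‖z‖)
    (hB0 : ∀ z, Filter.Tendsto (fun t => B t z) Filter.cofinite (nhds 0))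

include hzero in
theorem haydonSum_eq_sum {s : Finset (ℕ × L)} {z : Z}
    (hs : ∀ p ∉ s, A p.2 z + haydonWeight p.1 * B p.2 z ≤ 1) :
    haydonSum h A B z = ∑ p ∈ s, h (4 ^ p.1 * (A p.2 z + haydonWeight p.1 * B p.2 z - 1)) :=
  tsum_eq_sum fun p hp => hzero _ <|
    mul_nonpos_of_nonneg_of_nonpos (by positivity) (sub_nonpos.2 (hs p hp))

include hzero hK hA hB hB0 in
theorem convexOn_haydonSum (hconv : ConvexOn ℝ Set.univ h) (hmono : Monotone h) :
    ConvexOn ℝ (subunitRegion A B) (haydonSum h A B) := by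
  classical
  refine ⟨convex_subunitRegion A B, fun x hx y hy a b ha hb hab => ?_⟩
  obtain ⟨s₁, h₁⟩ := exists_finset_forall_notMem_lt_one hK hA hB hB0 hx
  obtain ⟨s₂, h₂⟩ := exists_finset_forall_notMem_lt_one hK hA hB hB0 hy
  obtain ⟨s₃, h₃⟩ := exists_finset_forall_notMem_lt_one hK hA hB hB0
    (convex_subunitRegion A B hx hy ha hb hab)
  rw [haydonSum_eq_sum hzero (s := s₁ ∪ s₂ ∪ s₃) fun p hp => h₁.self_of_nhds p (by simp_all),
    haydonSum_eq_sum hzero (s := s₁ ∪ s₂ ∪ s₃) fun p hp => h₂.self_of_nhds p (by simp_all),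
    haydonSum_eq_sum hzero (s := s₁ ∪ s₂ ∪ s₃) fun p hp => h₃.self_of_nhds p (by simp_all),
    smul_eq_mul, smul_eq_mul, Finset.mul_sum, Finset.mul_sum, ← Finset.sum_add_distrib]
  refine Finset.sum_le_sum fun p _ => ?_
  refine le_trans (hmono ?_) (hconv.2 (Set.mem_univ _) (Set.mem_univ _) ha hb hab)
  have h1 : A p.2 (a • x + b • y) ≤ a * A p.2 x + b * A p.2 y :=
    (map_add_le_add (A p.2) _ _).trans_eq (by simp [map_smul_eq_mul, abs_of_nonneg, ha, hb])
  have h2 : B p.2 (a • x + b • y) ≤ a * B p.2 x + b * B p.2 y :=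
    (map_add_le_add (B p.2) _ _).trans_eq (by simp [map_smul_eq_mul, abs_of_nonneg, ha, hb])
  have h3 := mul_le_mul_of_nonneg_left h2 (haydonWeight_pos p.1).le
  have h4 : A p.2 (a • x + b • y) + haydonWeight p.1 * B p.2 (a • x + b • y) - 1 ≤
      a * (A p.2 x + haydonWeight p.1 * B p.2 x - 1) +
        b * (A p.2 y + haydonWeight p.1 * B p.2 y - 1) := by
    have : (1 : ℝ) = a * 1 + b * 1 := by rw [mul_one, mul_one, hab]
    linear_combination h1 + h3 - this
  calc _ ≤ (4 : ℝ) ^ p.1 * (a * (A p.2 x + haydonWeight p.1 * B p.2 x - 1) +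
        b * (A p.2 y + haydonWeight p.1 * B p.2 y - 1)) :=
        mul_le_mul_of_nonneg_left h4 (by positivity)
    _ = _ := by simp only [smul_eq_mul]; ring

include hzero hK hA hB hB0 in
theorem contDiffAt_haydonSum {k : ℕ∞} (hsm : ContDiff ℝ (⊤ : ℕ∞) h)
    (hAsm : ∀ t z, A t z ≠ 0 → ContDiffAt ℝ k (A t) z)
    (hBsm : ∀ t z, B t z ≠ 0 → ContDiffAt ℝ k (B t) z)
    (hAc : ∀ t, Continuous (A t)) (hBc : ∀ t, Continuous (B t))
    {z : Z} (hz : z ∈ subunitRegion A B) : ContDiffAt ℝ k (haydonSum h A B) z := by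
  obtain ⟨s, hs⟩ := exists_finset_forall_notMem_lt_one hK hA hB hB0 hz
  refine ContDiffAt.congr_of_eventuallyEq (f := fun w =>
    ∑ p ∈ s, h (4 ^ p.1 * (A p.2 w + haydonWeight p.1 * B p.2 w - 1))) ?_
    (hs.mono fun w hw => haydonSum_eq_sum hzero hw)
  refine ContDiffAt.sum fun p _ => ?_
  obtain ⟨n, t⟩ := p
  dsimp only
  have hA0 : 0 ≤ A t z := apply_nonneg _ _
  have hB1 : 0 ≤ B t z := apply_nonneg _ _
  have hle : haydonWeight n * B t z ≤ B t z := mul_le_of_le_one_left hB1 (haydonWeight_le_one n)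
  obtain ⟨m, hm, hz⟩ := hz
  obtain ⟨h5, h6⟩ := hz t
  by_cases hlt : A t z + haydonWeight n * B t z < 1
  · have hc : Continuous fun w => A t w + haydonWeight n * B t w :=
      (hAc t).add (continuous_const.mul (hBc t))
    refine (contDiffAt_const (c := (0 : ℝ))).congr_of_eventuallyEq ?_
    filter_upwards [hc.continuousAt.eventually (gt_mem_nhds hlt)] with w hw
    exact hzero _ (mul_nonpos_of_nonneg_of_nonpos (by positivity) (by linarith))
  -- On an active term, `A t z = 0` would contradict `B t z ≤ m < 1`, and `B t z = 0` would
  -- contradict `A t z + B t z / 2 ≤ m < 1`.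
  · have hApos : A t z ≠ 0 := by
      intro h0; linarith
    have hBpos : B t z ≠ 0 := by
      intro h0; rw [h0] at hlt h5; linarith
    have hk : (k : WithTop ℕ∞) ≤ ((⊤ : ℕ∞) : WithTop ℕ∞) := by exact_mod_cast le_top
    refine (hsm.of_le hk).contDiffAt.comp z ?_
    exact contDiffAt_const.mul
      (((hAsm t z hApos).add (contDiffAt_const.mul (hBsm t z hBpos))).sub contDiffAt_const)

-- Indices with `A t + B t / 2` at least a value exceeding `m` have `B t` bounded below, since `A t
-- ≤ m`. They are therefore finite in number, and the maximum is attained.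
include hB0 in
theorem exists_max_add_half {z : Z}
    (hU : ∃ m, (∀ t, A t z ≤ m ∧ B t z ≤ m) ∧ ∃ s, m < A s z + 1 / 2 * B s z) :
    ∃ s m, (∀ t, A t z ≤ m ∧ B t z ≤ m) ∧ m < A s z + 1 / 2 * B s z ∧
      ∀ t, A t z + 1 / 2 * B t z ≤ A s z + 1 / 2 * B s z := by
  obtain ⟨m, hm, s₀, hs₀⟩ := hU
  set M : L → ℝ := fun t => A t z + 1 / 2 * B t z with hM
  have hfin : {t | M s₀ ≤ M t}.Finite := by
    have : {t | ¬ B t z < M s₀ - m}.Finite :=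
      (hB0 z).eventually (gt_mem_nhds (sub_pos.2 hs₀))
    refine this.subset fun t ht => ?_
    have h1 : M s₀ ≤ A t z + 1 / 2 * B t z := ht
    have h2 : 0 ≤ B t z := apply_nonneg _ _
    have h3 := (hm t).1
    change ¬ B t z < M s₀ - m
    linarith
  obtain ⟨s, hs, hmax⟩ := hfin.exists_maximalFor M _ ⟨s₀, le_refl (M s₀)⟩
  have hs' : M s₀ ≤ M s := hs
  refine ⟨s, m, hm, hs₀.trans_le hs, fun t => ?_⟩
  rcases le_total (M t) (M s) with h | h
  · exact h
  · exact hmax (j := t) (hs'.trans h) h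

include hzero hK hA hB hB0 in
theorem exists_haydonSum_eq_one (hmono : Monotone h) (h1 : h 1 = 1)
    (hcont : ContinuousOn (haydonSum h A B) (subunitRegion A B)) {z : Z}
    (hU : ∃ m, (∀ t, A t z ≤ m ∧ B t z ≤ m) ∧ ∃ s, m < A s z + 1 / 2 * B s z) :
    ∃ r : ℝ, 0 < r ∧ r • z ∈ subunitRegion A B ∧ haydonSum h A B (r • z) = 1 := by
  obtain ⟨s, m, hm, hs, hmax⟩ := exists_max_add_half hB0 hU
  set M := A s z + 1 / 2 * B s z with hM
  have hm0 : 0 ≤ m := (apply_nonneg _ _).trans (hm s).1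
  have hM0 : 0 < M := hm0.trans_lt hs
  have hBs : 0 < B s z := by
    have := (hm s).1
    linarith
  have hmem : ∀ r : ℝ, 0 ≤ r → r < M⁻¹ → r • z ∈ subunitRegion A B := by
    intro r hr hrM
    refine ⟨r * M, (lt_inv_mul_iff₀' hM0).1 (by simpa using hrM), fun t => ?_⟩
    simp only [map_smul_eq_mul, Real.norm_eq_abs, abs_of_nonneg hr]
    constructor
    · have := mul_le_mul_of_nonneg_left (hmax t) hr
      linarith
    · exact mul_le_mul_of_nonneg_left ((hm t).2.trans hs.le) hr
  -- Raising the weight from `1/2` gains `2 ^ (-n) * B s z / 2` over `M`. For this `n` the gain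
  -- exceeds `4 ^ (-n) * M`, the margin that the factor `4 ^ n` inside the ramp needs.
  obtain ⟨n, hn⟩ := exists_pow_lt_of_lt_one (show 0 < B s z / (2 * M) by positivity)
    (show (1 / 2 : ℝ) < 1 by norm_num)
  set P := A s z + haydonWeight n * B s z with hP
  have hPM : (1 + (1 / 4 : ℝ) ^ n) * M < P := by
    have e1 : (1 / 4 : ℝ) ^ n = (1 / 2) ^ n * (1 / 2) ^ n := by
      rw [← mul_pow]; norm_num
    have e2 : (1 / 2 : ℝ) ^ n * (2 * M) < B s z := (lt_div_iff₀ (by positivity)).1 hn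
    have e3 : 0 < (1 / 2 : ℝ) ^ n := by positivity
    have e4 := mul_lt_mul_of_pos_left e2 e3
    have e5 : P = M + 1 / 2 * ((1 / 2) ^ n * B s z) := by
      rw [hP, hM, haydonWeight]; ring
    rw [e5, e1]
    linarith
  have hP0 : 0 < P := lt_trans (by positivity) hPM
  -- At this radius the ramp indexed by `(n, s)` has argument exactly `1`, while `r₁ < M⁻¹` keeps
  -- the point in the region.
  set r₁ := (1 + (1 / 4 : ℝ) ^ n) / P
  have hr₁ : 0 < r₁ := by positivity
  have hr₁M : r₁ < M⁻¹ := by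
    rw [div_lt_iff₀ hP0, ← div_eq_inv_mul, lt_div_iff₀ hM0]; exact hPM
  have hbig : 1 ≤ haydonSum h A B (r₁ • z) := by
    obtain ⟨F, hF⟩ := exists_finset_forall_notMem_lt_one hK hA hB hB0 (hmem r₁ hr₁.le hr₁M)
    have hval : 4 ^ n * (A s (r₁ • z) + haydonWeight n * B s (r₁ • z) - 1) = (1 : ℝ) := by
      have e1 : A s (r₁ • z) + haydonWeight n * B s (r₁ • z) = r₁ * P := by
        simp only [map_smul_eq_mul, Real.norm_eq_abs, abs_of_nonneg hr₁.le, hP]; ring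
      rw [e1, div_mul_cancel₀ _ hP0.ne', add_sub_cancel_left, ← mul_pow]; norm_num
    have hmemF : (n, s) ∈ F := by
      by_contra hnot
      have := hF.self_of_nhds (n, s) hnot
      dsimp only at this
      have h4 : (0 : ℝ) < 4 ^ n := by positivity
      nlinarith
    rw [haydonSum_eq_sum hzero hF.self_of_nhds]
    calc (1 : ℝ) = h (4 ^ n * (A s (r₁ • z) + haydonWeight n * B s (r₁ • z) - 1)) := by
          rw [hval, h1]
      _ ≤ _ := Finset.single_le_sum
          (f := fun p : ℕ × L => h (4 ^ p.1 * (A p.2 (r₁ • z) + haydonWeight p.1 * B p.2 (r₁ • z) - 1)))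
          (fun p _ => ?_) hmemF
    rcases le_total 0 (4 ^ p.1 * (A p.2 (r₁ • z) + haydonWeight p.1 * B p.2 (r₁ • z) - 1)) with h' | h'
    · exact (hzero 0 le_rfl).symm.le.trans (hmono h')
    · exact (hzero _ h').ge
  have hc : ContinuousOn (fun r : ℝ => haydonSum h A B (r • z)) (Set.Icc 0 r₁) :=
    hcont.comp (by fun_prop) fun r hr => hmem r hr.1 (hr.2.trans_lt hr₁M)
  have hz0 : haydonSum h A B ((0 : ℝ) • z) = 0 := by
    rw [haydonSum_eq_sum hzero (s := ∅)] <;> simp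
  obtain ⟨r, hr, hr1⟩ := intermediate_value_Icc hr₁.le hc
    (show (1 : ℝ) ∈ Set.Icc _ _ from ⟨by rw [hz0]; exact zero_le_one, hbig⟩)
  refine ⟨r, hr.1.lt_of_ne ?_, hmem r hr.1 (hr.2.trans_lt hr₁M), hr1⟩
  rintro rfl
  simp only [hz0] at hr1
  exact zero_ne_one hr1

end

/-- A Banach space with a separating family `A` and a vanishing family `B` of seminorms, smooth off
their kernels, such that the pairs `(A · z, B · z)` satisfy Haydon's strict inequalities. -/
theorem hasEquivSmoothNorm_of_seminorm_families {Z L : Type*} [NormedAddCommGroup Z]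
    [NormedSpace ℝ Z] [CompleteSpace Z] {k : ℕ∞} (hk : k ≠ 0) {A B : L → Seminorm ℝ Z} {K : ℝ}
    (hK : 0 ≤ K) (hA : ∀ t z, A t z ≤ K * ‖z‖) (hB : ∀ t z, B t z ≤ K * ‖z‖)
    (hAsm : ∀ t z, A t z ≠ 0 → ContDiffAt ℝ k (A t) z)
    (hBsm : ∀ t z, B t z ≠ 0 → ContDiffAt ℝ k (B t) z)
    (hAc : ∀ t, Continuous (A t)) (hBc : ∀ t, Continuous (B t))
    (hB0 : ∀ z, Filter.Tendsto (fun t => B t z) Filter.cofinite (nhds 0))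
    {R : ℝ} (hR : 0 < R) (hlow : ∀ z m, 0 ≤ m → (∀ t, A t z ≤ m) → ‖z‖ ≤ R * m)
    (hU : ∀ z, z ≠ 0 → ∃ m, (∀ t, A t z ≤ m ∧ B t z ≤ m) ∧ ∃ s, m < A s z + 1 / 2 * B s z) :
    HasEquivSmoothNorm Z k := by
  obtain ⟨h, hsm, hconv, hmono, hzero, h1⟩ := exists_smooth_convex_ramp
  have hC : ∀ z ∈ subunitRegion A B, ContDiffAt ℝ k (haydonSum h A B) z := fun z hz =>
    contDiffAt_haydonSum hzero hK hA hB hB0 hsm hAsm hBsm hAc hBc hz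
  refine hasEquivSmoothNorm_of_convexOn hk (isOpen_subunitRegion hK hA hB)
    (convex_subunitRegion A B) ⟨0, one_pos, by simp⟩ ?_ hR ?_
    (convexOn_haydonSum hzero hK hA hB hB0 hconv hmono) ?_ ?_ hC fun z hz =>
      exists_haydonSum_eq_one hzero hK hA hB hB0 hmono h1
        (fun w hw => (hC w hw).continuousAt.continuousWithinAt) (hU z hz)
  · rintro z ⟨m, hm, hz⟩
    exact ⟨m, hm, by simpa using hz⟩
  · rintro z ⟨m, hm, hz⟩
    have := hlow z 1 zero_le_one fun t => by
      have := (hz t).1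
      have h2 : 0 ≤ B t z := apply_nonneg _ _
      linarith
    simpa using this
  · rw [haydonSum_eq_sum hzero (s := ∅)] <;> simp
  · intro z
    simp [haydonSum]

/-! ### Dual balls of seminorms -/

/-- Hahn–Banach with `N` as the sublinear bound; the bound by `C` makes the extension continuous. -/
theorem Seminorm.exists_strongDual_eq {E : Type*} [NormedAddCommGroup E] [NormedSpace ℝ E]
    (N : Seminorm ℝ E) {C : ℝ} (hC : ∀ e, N e ≤ C * ‖e‖) (e : E) :
    ∃ η : StrongDual ℝ E, (∀ v, |η v| ≤ N v) ∧ η e = N e := by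
  by_cases he : e = 0
  · exact ⟨0, fun v => by simp, by simp [he]⟩
  obtain ⟨g, hg, hgN⟩ := exists_extension_of_le_sublinear
    (LinearPMap.mkSpanSingleton e (N e) he) N
    (fun c hc x => by rw [map_smul_eq_mul, Real.norm_of_nonneg hc.le]) (map_add_le_add N) (by
      rintro ⟨x, hx⟩
      obtain ⟨c, rfl⟩ := Submodule.mem_span_singleton.1 hx
      have hc : LinearPMap.mkSpanSingleton e (N e) he ⟨c • e, hx⟩ = c • N e :=
        LinearPMap.mkSpanSingleton'_apply e (N e) _ c hx
      rw [hc, smul_eq_mul, map_smul_eq_mul]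
      exact mul_le_mul_of_nonneg_right (le_abs_self c) (apply_nonneg _ _))
  have habs : ∀ v, |g v| ≤ N v := fun v => abs_le'.2 ⟨hgN v, by simpa using hgN (-v)⟩
  refine ⟨g.mkContinuous C fun v => (habs v).trans (hC v), habs, ?_⟩
  have := hg ⟨e, Submodule.mem_span_singleton_self e⟩
  rwa [LinearPMap.mkSpanSingleton_apply] at this

/-- The functionals dominated by a seminorm, in the weak-* topology. -/
def Seminorm.weakDualBall {E : Type*} [NormedAddCommGroup E] [NormedSpace ℝ E]
    (N : Seminorm ℝ E) : Set (WeakDual ℝ E) :=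
  {η | ∀ e, |η e| ≤ N e}

theorem Seminorm.norm_le_of_mem_weakDualBall {E : Type*} [NormedAddCommGroup E] [NormedSpace ℝ E]
    {N : Seminorm ℝ E} {C : ℝ} (hC0 : 0 ≤ C) (hC : ∀ e, N e ≤ C * ‖e‖) {η : WeakDual ℝ E}
    (hη : η ∈ N.weakDualBall) : ‖WeakDual.toStrongDual η‖ ≤ C :=
  ContinuousLinearMap.opNorm_le_bound _ hC0 fun e => (hη e).trans (hC e)

theorem Seminorm.isCompact_weakDualBall {E : Type*} [NormedAddCommGroup E] [NormedSpace ℝ E]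
    {N : Seminorm ℝ E} {C : ℝ} (hC0 : 0 ≤ C) (hC : ∀ e, N e ≤ C * ‖e‖) :
    IsCompact N.weakDualBall := by
  refine (WeakDual.isCompact_closedBall (0 : StrongDual ℝ E) C).of_isClosed_subset ?_ ?_
  · simp only [weakDualBall, Set.ofPred_forall]
    exact isClosed_iInter fun e =>
      isClosed_le (WeakDual.eval_continuous e).abs continuous_const
  · intro η hη
    simpa using norm_le_of_mem_weakDualBall hC0 hC hη

/-! ### Slice maps on the injective tensor product -/

section Slices

variable {X E : Type*} [NormedAddCommGroup X] [NormedSpace ℝ X]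
  [NormedAddCommGroup E] [NormedSpace ℝ E]

theorem abs_tensorForm_le (ξ : StrongDual ℝ X) (η : StrongDual ℝ E) (z : AlgTensor X E) :
    |tensorForm ξ η z| ≤ ‖ξ‖ * ‖η‖ * ‖z‖ := by
  have hsmul : ∀ (a b : ℝ) (ξ' : StrongDual ℝ X) (η' : StrongDual ℝ E),
      tensorForm (a • ξ') (b • η') z = a * b * tensorForm ξ' η' z := by
    intro a b ξ' η'
    have : TensorProduct.dualDistrib ℝ X E
        (((a • ξ' : StrongDual ℝ X) : X →ₗ[ℝ] ℝ) ⊗ₜ[ℝ] ((b • η' : StrongDual ℝ E) : E →ₗ[ℝ] ℝ)) =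
        (a * b) • TensorProduct.dualDistrib ℝ X E ((ξ' : X →ₗ[ℝ] ℝ) ⊗ₜ[ℝ] (η' : E →ₗ[ℝ] ℝ)) := by
      rw [ContinuousLinearMap.toLinearMap_smul, ContinuousLinearMap.toLinearMap_smul,
        TensorProduct.smul_tmul_smul, map_smul]
    exact LinearMap.congr_fun this z
  by_cases hξ : ξ = 0
  · have := hsmul 0 1 0 η
    simp_all
  by_cases hη : η = 0
  · have := hsmul 1 0 ξ 0
    simp_all
  have hξ' : 0 < ‖ξ‖ := norm_pos_iff.2 hξ
  have hη' : 0 < ‖η‖ := norm_pos_iff.2 hη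
  -- Normalising both functionals gives a pair over which the injective norm is a supremum.
  have h := hsmul ‖ξ‖ ‖η‖ (‖ξ‖⁻¹ • ξ) (‖η‖⁻¹ • η)
  rw [smul_inv_smul₀ hξ'.ne', smul_inv_smul₀ hη'.ne'] at h
  rw [h, abs_mul, abs_of_pos (mul_pos hξ' hη')]
  refine mul_le_mul_of_nonneg_left ?_ (by positivity)
  rw [AlgTensor.norm_def]
  refine le_ciSup (injNorm_bddAbove z) (⟨⟨‖ξ‖⁻¹ • ξ, ?_⟩, ⟨‖η‖⁻¹ • η, ?_⟩⟩ : DualBalls X E)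
  · simp [norm_smul, hξ'.ne']
  · simp [norm_smul, hη'.ne']

/-- The linear map `ξ ⊗ id` from `X ⊙ E` to `E`. -/
noncomputable def tensorSliceLeftₗ (ξ : StrongDual ℝ X) : AlgTensor X E →ₗ[ℝ] E :=
  TensorProduct.lift ((LinearMap.lsmul ℝ E).comp (ξ : X →ₗ[ℝ] ℝ))

/-- The linear map `id ⊗ η` from `X ⊙ E` to `X`. -/
noncomputable def tensorSliceRightₗ (η : StrongDual ℝ E) : AlgTensor X E →ₗ[ℝ] X :=
  TensorProduct.lift ((LinearMap.lsmul ℝ X).comp (η : E →ₗ[ℝ] ℝ)).flip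

theorem tensorSliceLeftₗ_tmul (ξ : StrongDual ℝ X) (x : X) (e : E) :
    tensorSliceLeftₗ ξ (x ⊗ₜ[ℝ] e : X ⊗[ℝ] E) = ξ x • e := rfl

theorem tensorSliceRightₗ_tmul (η : StrongDual ℝ E) (x : X) (e : E) :
    tensorSliceRightₗ η (x ⊗ₜ[ℝ] e : X ⊗[ℝ] E) = η e • x := rfl

theorem apply_tensorSliceLeftₗ (ξ : StrongDual ℝ X) (η : StrongDual ℝ E) (z : AlgTensor X E) :
    η (tensorSliceLeftₗ ξ z) = tensorForm ξ η z := by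
  induction z using TensorProduct.induction_on with
  | zero =>
    exact (map_zero ((η : E →ₗ[ℝ] ℝ) ∘ₗ tensorSliceLeftₗ ξ)).trans
      (map_zero (tensorForm ξ η)).symm
  | tmul x e =>
    rw [tensorSliceLeftₗ_tmul, tensorForm_tmul, map_smul, smul_eq_mul]
  | add a b ha hb =>
    exact (map_add ((η : E →ₗ[ℝ] ℝ) ∘ₗ tensorSliceLeftₗ ξ) a b).trans
      ((congrArg₂ (· + ·) ha hb).trans (map_add (tensorForm ξ η) a b).symm)

theorem apply_tensorSliceRightₗ (ξ : StrongDual ℝ X) (η : StrongDual ℝ E) (z : AlgTensor X E) :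
    ξ (tensorSliceRightₗ η z) = tensorForm ξ η z := by
  induction z using TensorProduct.induction_on with
  | zero =>
    exact (map_zero ((ξ : X →ₗ[ℝ] ℝ) ∘ₗ tensorSliceRightₗ η)).trans
      (map_zero (tensorForm ξ η)).symm
  | tmul x e =>
    rw [tensorSliceRightₗ_tmul, tensorForm_tmul, map_smul, smul_eq_mul, mul_comm]
  | add a b ha hb =>
    exact (map_add ((ξ : X →ₗ[ℝ] ℝ) ∘ₗ tensorSliceRightₗ η) a b).trans
      ((congrArg₂ (· + ·) ha hb).trans (map_add (tensorForm ξ η) a b).symm)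

theorem norm_tensorSliceLeftₗ_le (ξ : StrongDual ℝ X) (z : AlgTensor X E) :
    ‖tensorSliceLeftₗ ξ z‖ ≤ ‖ξ‖ * ‖z‖ := by
  refine NormedSpace.norm_le_dual_bound ℝ _ (by positivity) fun η => ?_
  rw [apply_tensorSliceLeftₗ, Real.norm_eq_abs]
  exact (abs_tensorForm_le ξ η z).trans_eq (by ring)

theorem norm_tensorSliceRightₗ_le (η : StrongDual ℝ E) (z : AlgTensor X E) :
    ‖tensorSliceRightₗ η z‖ ≤ ‖η‖ * ‖z‖ := by
  refine NormedSpace.norm_le_dual_bound ℝ _ (by positivity) fun ξ => ?_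
  rw [apply_tensorSliceRightₗ, Real.norm_eq_abs]
  exact (abs_tensorForm_le ξ η z).trans_eq (by ring)

/-- The extension of `ξ ⊗ id` to the injective tensor product. -/
noncomputable def tensorSliceLeft [CompleteSpace E] (ξ : StrongDual ℝ X) :
    InjectiveTensor X E →L[ℝ] E :=
  ((tensorSliceLeftₗ ξ).mkContinuous ‖ξ‖ (norm_tensorSliceLeftₗ_le ξ)).extend
    UniformSpace.Completion.toComplL

/-- The extension of `id ⊗ η` to the injective tensor product. -/
noncomputable def tensorSliceRight [CompleteSpace X] (η : StrongDual ℝ E) :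
    InjectiveTensor X E →L[ℝ] X :=
  ((tensorSliceRightₗ η).mkContinuous ‖η‖ (norm_tensorSliceRightₗ_le η)).extend
    UniformSpace.Completion.toComplL

theorem tensorSliceLeft_coe [CompleteSpace E] (ξ : StrongDual ℝ X) (z : AlgTensor X E) :
    tensorSliceLeft ξ (z : InjectiveTensor X E) = tensorSliceLeftₗ ξ z :=
  ContinuousLinearMap.extend_eq _ UniformSpace.Completion.denseRange_coe
    (UniformSpace.Completion.isUniformInducing_coe _) z

theorem tensorSliceRight_coe [CompleteSpace X] (η : StrongDual ℝ E) (z : AlgTensor X E) :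
    tensorSliceRight η (z : InjectiveTensor X E) = tensorSliceRightₗ η z :=
  ContinuousLinearMap.extend_eq _ UniformSpace.Completion.denseRange_coe
    (UniformSpace.Completion.isUniformInducing_coe _) z

theorem norm_tensorSliceLeft_le [CompleteSpace E] (ξ : StrongDual ℝ X) (z : InjectiveTensor X E) :
    ‖tensorSliceLeft ξ z‖ ≤ ‖ξ‖ * ‖z‖ := by
  induction z using UniformSpace.Completion.induction_on with
  | hp => exact isClosed_le (by fun_prop) (by fun_prop)
  | ih z =>
    rw [tensorSliceLeft_coe, UniformSpace.Completion.norm_coe]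
    exact norm_tensorSliceLeftₗ_le ξ z

theorem norm_tensorSliceRight_le [CompleteSpace X] (η : StrongDual ℝ E)
    (z : InjectiveTensor X E) : ‖tensorSliceRight η z‖ ≤ ‖η‖ * ‖z‖ := by
  induction z using UniformSpace.Completion.induction_on with
  | hp => exact isClosed_le (by fun_prop) (by fun_prop)
  | ih z =>
    rw [tensorSliceRight_coe, UniformSpace.Completion.norm_coe]
    exact norm_tensorSliceRightₗ_le η z

theorem apply_tensorSliceLeft_eq [CompleteSpace X] [CompleteSpace E] (ξ : StrongDual ℝ X)
    (η : StrongDual ℝ E) (z : InjectiveTensor X E) :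
    η (tensorSliceLeft ξ z) = ξ (tensorSliceRight η z) := by
  induction z using UniformSpace.Completion.induction_on with
  | hp => exact isClosed_eq (by fun_prop) (by fun_prop)
  | ih z =>
    rw [tensorSliceLeft_coe, tensorSliceRight_coe, apply_tensorSliceLeftₗ, apply_tensorSliceRightₗ]

theorem exists_algTensor_norm_sub_lt (z : InjectiveTensor X E) {ε : ℝ} (hε : 0 < ε) :
    ∃ w : AlgTensor X E, ‖z - (w : InjectiveTensor X E)‖ < ε := by
  obtain ⟨w, hw⟩ := UniformSpace.Completion.denseRange_coe.exists_dist_lt z hε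
  exact ⟨w, by rwa [← dist_eq_norm]⟩

theorem norm_le_of_forall_norm_tensorSliceRight_le [CompleteSpace X] {z : InjectiveTensor X E}
    {m : ℝ} (h : ∀ η : StrongDual ℝ E, ‖η‖ ≤ 1 → ‖tensorSliceRight η z‖ ≤ m) : ‖z‖ ≤ m := by
  refine le_of_forall_pos_le_add fun ε hε => ?_
  obtain ⟨w, hw⟩ := exists_algTensor_norm_sub_lt z (half_pos hε)
  have h1 : ‖w‖ ≤ m + ε / 2 := by
    rw [AlgTensor.norm_def]
    refine ciSup_le fun p => ?_
    have hξ : ‖p.1.1‖ ≤ 1 := mem_closedBall_zero_iff.1 p.1.2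
    have hη : ‖p.2.1‖ ≤ 1 := mem_closedBall_zero_iff.1 p.2.2
    rw [← apply_tensorSliceRightₗ, ← tensorSliceRight_coe]
    have h2 : tensorSliceRight p.2.1 (w : InjectiveTensor X E) =
        tensorSliceRight p.2.1 z - tensorSliceRight p.2.1 (z - (w : InjectiveTensor X E)) := by rw [map_sub]; abel
    have h3 : ‖tensorSliceRight p.2.1 (z - (w : InjectiveTensor X E))‖ ≤ ε / 2 :=
      (norm_tensorSliceRight_le _ _).trans
        ((mul_le_of_le_one_left (norm_nonneg _) hη).trans hw.le)
    calc |p.1.1 (tensorSliceRight p.2.1 (w : InjectiveTensor X E))|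
        ≤ ‖p.1.1‖ * ‖tensorSliceRight p.2.1 (w : InjectiveTensor X E)‖ := p.1.1.le_opNorm _
      _ ≤ ‖tensorSliceRight p.2.1 (w : InjectiveTensor X E)‖ :=
        mul_le_of_le_one_left (norm_nonneg _) hξ
      _ ≤ m + ε / 2 := by
        rw [h2]
        exact (norm_sub_le _ _).trans (add_le_add (h _ hη) h3)
  have h4 : ‖z‖ ≤ ‖z - (w : InjectiveTensor X E)‖ + ‖(w : InjectiveTensor X E)‖ := by
    simpa using norm_add_le (z - (w : InjectiveTensor X E)) (w : InjectiveTensor X E)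
  rw [UniformSpace.Completion.norm_coe] at h4
  linarith

theorem continuous_tensorSliceRightₗ (z : AlgTensor X E) :
    Continuous fun η : WeakDual ℝ E => tensorSliceRightₗ (WeakDual.toStrongDual η) z := by
  induction z using TensorProduct.induction_on with
  | zero =>
    refine (continuous_const (y := (0 : X))).congr fun η => ?_
    exact (map_zero (tensorSliceRightₗ (X := X) (WeakDual.toStrongDual η))).symm
  | tmul x e => exact (WeakDual.eval_continuous e).smul continuous_const
  | add a b ha hb =>
    refine (ha.add hb).congr fun η => ?_
    exact (map_add (tensorSliceRightₗ (X := X) (WeakDual.toStrongDual η)) a b).symm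

/-- For algebraic tensors the slice is a finite sum of terms `η e • x`, hence weak-* to norm
continuous. On bounded sets of functionals, approximating `z` in norm approximates its slices
uniformly. -/
theorem continuousOn_tensorSliceRight [CompleteSpace X] (z : InjectiveTensor X E) {C : ℝ}
    {s : Set (WeakDual ℝ E)} (hs : ∀ η ∈ s, ‖WeakDual.toStrongDual η‖ ≤ C) :
    ContinuousOn (fun η : WeakDual ℝ E => tensorSliceRight (WeakDual.toStrongDual η) z) s := by
  refine continuousOn_of_uniform_approx_of_continuousOn fun u hu => ?_
  obtain ⟨ε, hε, hεu⟩ := Metric.mem_uniformity_dist.1 hu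
  obtain ⟨w, hw⟩ := exists_algTensor_norm_sub_lt z (show 0 < ε / (|C| + 1) by positivity)
  refine ⟨_, (continuous_tensorSliceRightₗ w).continuousOn, fun η hη => hεu ?_⟩
  rw [← tensorSliceRight_coe, dist_eq_norm, ← map_sub]
  rw [lt_div_iff₀ (by positivity)] at hw
  have h1 := norm_tensorSliceRight_le (WeakDual.toStrongDual η) (z - (w : InjectiveTensor X E))
  have h2 : ‖WeakDual.toStrongDual η‖ ≤ |C| := (hs η hη).trans (le_abs_self C)
  have h3 := norm_nonneg (z - (w : InjectiveTensor X E))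
  nlinarith

end Slices

/-! ### Coordinates in `ℓ_∞(L)` and general estimates -/

/-- The coordinate functional `f ↦ f t` on `ℓ_∞(L)`. -/
noncomputable def LInfty.coord {L : Type*} (t : L) : StrongDual ℝ (LInfty L) :=
  LinearMap.mkContinuous (lp.evalₗ (𝕜 := ℝ) (fun _ : L => ℝ) ∞ t) 1 fun f => by
    rw [one_mul]
    exact lp.norm_apply_le_norm ENNReal.top_ne_zero f t

theorem LInfty.norm_coord_le {L : Type*} (t : L) : ‖LInfty.coord t‖ ≤ 1 :=
  LinearMap.mkContinuous_norm_le _ zero_le_one _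

theorem LInfty.norm_le_iff {L : Type*} {f : LInfty L} {m : ℝ} (hm : 0 ≤ m) :
    ‖f‖ ≤ m ↔ ∀ t, |f t| ≤ m :=
  ⟨fun h t => (lp.norm_apply_le_norm ENNReal.top_ne_zero f t).trans h,
    fun h => lp.norm_le_of_forall_le hm h⟩

theorem exists_lt_of_mem_haydonSet {L : Type*} {p : LInfty L × cZero L} (hp : p ∈ haydonSet L)
    {m : ℝ} (hm : m ≤ max ‖p.1‖ ‖p.2‖) :
    ∃ t, m < |p.1 t| + 1 / 2 * |(p.2 : LInfty L) t| := by
  have hlt := hm.trans_lt (max_lt hp.1 hp.2)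
  rcases isEmpty_or_nonempty L with hL | hL
  -- A real supremum over the empty type is `0`, and no norm lies strictly below it.
  · have h1 := hp.1
    rw [Real.iSup_of_isEmpty] at h1
    exact absurd h1 (norm_nonneg _).not_gt
  · exact exists_lt_of_lt_ciSup hlt

theorem exists_bound_of_isEmbedding {X Y : Type*} [NormedAddCommGroup X] [NormedSpace ℝ X]
    [NormedAddCommGroup Y] [NormedSpace ℝ Y] {S : X →L[ℝ] Y} (hS : Topology.IsEmbedding S) :
    ∃ R : ℝ, 0 < R ∧ ∀ x, ‖x‖ ≤ R * ‖S x‖ := by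
  obtain ⟨K, hK⟩ := S.antilipschitz_of_isEmbedding hS
  refine ⟨K + 1, by positivity, fun x => (hK.le_mul_norm (map_zero S) x).trans ?_⟩
  exact mul_le_mul_of_nonneg_right (by linarith) (norm_nonneg _)

theorem Seminorm.contDiffAt_comp {Z E : Type*} [NormedAddCommGroup Z] [NormedSpace ℝ Z]
    [NormedAddCommGroup E] [NormedSpace ℝ E] {k : ℕ∞} {N : Seminorm ℝ E}
    (hN : ContDiffOn ℝ k (fun e => N e) {e | e ≠ 0}) (F : Z →L[ℝ] E) (z : Z)
    (hz : N.comp (F : Z →ₗ[ℝ] E) z ≠ 0) : ContDiffAt ℝ k (N.comp (F : Z →ₗ[ℝ] E)) z := by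
  have hF : F z ≠ 0 := by
    intro h
    exact hz (by simp [Seminorm.comp_apply, h])
  have h1 : ContDiffAt ℝ k (fun e => N e) (F z) :=
    hN.contDiffAt (isOpen_ne.mem_nhds hF)
  exact h1.comp z F.contDiff.contDiffAt

theorem Seminorm.continuous_of_le_norm {E : Type*} [NormedAddCommGroup E] [NormedSpace ℝ E]
    {N : Seminorm ℝ E} {C : ℝ} (hC : ∀ e, N e ≤ C * ‖e‖) : Continuous N :=
  Seminorm.continuous_of_le (q := (|C|).toNNReal • normSeminorm ℝ E)
    (by
      have : Continuous fun e : E => (|C|).toNNReal * ‖e‖ := by fun_prop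
      exact this) fun e => by
        change N e ≤ ((|C|).toNNReal : ℝ) * ‖e‖
        rw [Real.coe_toNNReal _ (abs_nonneg C)]
        exact (hC e).trans (mul_le_mul_of_nonneg_right (le_abs_self C) (norm_nonneg _))

/-! ### Transfer of the strict inequalities to the tensor product -/

section Coordinates

variable {X : Type*} [NormedAddCommGroup X] [NormedSpace ℝ X] {L : Type*}

/-- The coordinate functionals of an operator into `ℓ_∞(L)`. -/
noncomputable def coordFunctional (S : X →L[ℝ] LInfty L) (t : L) : StrongDual ℝ X :=
  (LInfty.coord t).comp S

theorem coordFunctional_apply (S : X →L[ℝ] LInfty L) (t : L) (x : X) :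
    coordFunctional S t x = S x t := rfl

theorem norm_coordFunctional_le (S : X →L[ℝ] LInfty L) (t : L) : ‖coordFunctional S t‖ ≤ ‖S‖ :=
  (ContinuousLinearMap.opNorm_comp_le _ _).trans
    (mul_le_of_le_one_left (norm_nonneg _) (LInfty.norm_coord_le t))

/-- An operator into `c₀(L)`, as an operator into `ℓ_∞(L)`. -/
noncomputable def cZeroIncl (T : X →L[ℝ] cZero L) : X →L[ℝ] LInfty L :=
  (cZero L).subtypeL.comp T

theorem tendsto_coordFunctional_cZeroIncl (T : X →L[ℝ] cZero L) (x : X) :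
    Filter.Tendsto (fun t => coordFunctional (cZeroIncl T) t x) Filter.cofinite (nhds 0) :=
  (T x).2

variable {E : Type*} [NormedAddCommGroup E] [NormedSpace ℝ E]

/-- The seminorm `z ↦ N ((ξ ⊗ id) z)` on the injective tensor product. -/
noncomputable def sliceSeminorm [CompleteSpace E] (N : Seminorm ℝ E) (ξ : StrongDual ℝ X) :
    Seminorm ℝ (InjectiveTensor X E) :=
  N.comp (tensorSliceLeft (E := E) ξ).toLinearMap

theorem sliceSeminorm_apply [CompleteSpace E] (N : Seminorm ℝ E) (ξ : StrongDual ℝ X)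
    (z : InjectiveTensor X E) : sliceSeminorm N ξ z = N (tensorSliceLeft ξ z) := rfl

theorem contDiffAt_sliceSeminorm [CompleteSpace E] {N : Seminorm ℝ E} {k : ℕ∞}
    (hN : ContDiffOn ℝ k (fun e => N e) {e | e ≠ 0}) (ξ : StrongDual ℝ X)
    (z : InjectiveTensor X E) (hz : sliceSeminorm N ξ z ≠ 0) :
    ContDiffAt ℝ k (sliceSeminorm N ξ) z :=
  Seminorm.contDiffAt_comp hN (tensorSliceLeft ξ) z hz

/-- The decay is clear on elementary tensors, passes to finite sums, and extends to the completion
because the `ξ t` are uniformly bounded. -/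
theorem tendsto_seminorm_tensorSliceLeft [CompleteSpace E] (N : Seminorm ℝ E) {C : ℝ}
    (hC : ∀ e, N e ≤ C * ‖e‖) {ξ : L → StrongDual ℝ X} {K : ℝ}
    (hξ : ∀ t, ‖ξ t‖ ≤ K) (hξ0 : ∀ x, Filter.Tendsto (fun t => ξ t x) Filter.cofinite (nhds 0))
    (z : InjectiveTensor X E) :
    Filter.Tendsto (fun t => N (tensorSliceLeft (ξ t) z)) Filter.cofinite (nhds 0) := by
  have halg : ∀ w : AlgTensor X E,
      Filter.Tendsto (fun t => tensorSliceLeftₗ (ξ t) w) Filter.cofinite (nhds 0) := by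
    intro w
    induction w using TensorProduct.induction_on with
    | zero =>
      refine (tendsto_const_nhds (x := (0 : E))).congr fun t => ?_
      exact (map_zero (tensorSliceLeftₗ (E := E) (ξ t))).symm
    | tmul x e =>
      have := (hξ0 x).smul_const e
      rw [zero_smul] at this
      exact this
    | add a b ha hb =>
      have := ha.add hb
      rw [add_zero] at this
      refine this.congr fun t => ?_
      exact (map_add (tensorSliceLeftₗ (E := E) (ξ t)) a b).symm
  have hslice : Filter.Tendsto (fun t => tensorSliceLeft (ξ t) z) Filter.cofinite (nhds 0) := by
    rw [Metric.tendsto_nhds]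
    intro ε hε
    obtain ⟨w, hw⟩ := exists_algTensor_norm_sub_lt z
      (show 0 < ε / (2 * (|K| + 1)) by positivity)
    filter_upwards [Metric.tendsto_nhds.1 (halg w) (ε / 2) (half_pos hε)] with t ht
    rw [dist_zero_right, ← tensorSliceLeft_coe] at ht
    rw [dist_zero_right]
    rw [lt_div_iff₀ (by positivity)] at hw
    have h1 := norm_tensorSliceLeft_le (ξ t) (z - (w : InjectiveTensor X E))
    have h2 : ‖ξ t‖ ≤ |K| := (hξ t).trans (le_abs_self K)
    have h3 := norm_nonneg (z - (w : InjectiveTensor X E))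
    have h4 : ‖tensorSliceLeft (ξ t) z‖ ≤ ‖tensorSliceLeft (ξ t) (z - (w : InjectiveTensor X E))‖ +
        ‖tensorSliceLeft (ξ t) (w : InjectiveTensor X E)‖ := by
      rw [map_sub]
      simpa using norm_add_le (tensorSliceLeft (ξ t) z - tensorSliceLeft (ξ t) (w : InjectiveTensor X E))
        (tensorSliceLeft (ξ t) (w : InjectiveTensor X E))
    nlinarith
  have := ((Seminorm.continuous_of_le_norm hC).tendsto 0).comp hslice
  rwa [map_zero] at this

variable [CompleteSpace X] [CompleteSpace E]

theorem le_seminorm_tensorSliceLeft {N : Seminorm ℝ E} {η : WeakDual ℝ E}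
    (hη : η ∈ N.weakDualBall) (S : X →L[ℝ] LInfty L) (t : L) (z : InjectiveTensor X E) :
    |S (tensorSliceRight (WeakDual.toStrongDual η) z) t| ≤
      N (tensorSliceLeft (coordFunctional S t) z) := by
  rw [← coordFunctional_apply, ← apply_tensorSliceLeft_eq]
  exact hη _

/-- Some `η` in the dual ball of `N` attains `N` at the left slice; interchanging slices turns that
value into a coordinate of `S` at a right slice. -/
theorem seminorm_tensorSliceLeft_le {N : Seminorm ℝ E} {C : ℝ} (hC : ∀ e, N e ≤ C * ‖e‖)
    (S : X →L[ℝ] LInfty L) (z : InjectiveTensor X E) {m : ℝ}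
    (hm : ∀ η ∈ N.weakDualBall, ‖S (tensorSliceRight (WeakDual.toStrongDual η) z)‖ ≤ m) (t : L) :
    N (tensorSliceLeft (coordFunctional S t) z) ≤ m := by
  obtain ⟨η, hη, hηe⟩ := N.exists_strongDual_eq hC (tensorSliceLeft (coordFunctional S t) z)
  rw [← hηe, apply_tensorSliceLeft_eq, coordFunctional_apply]
  refine (le_abs_self _).trans ?_
  exact (lp.norm_apply_le_norm ENNReal.top_ne_zero _ t).trans
    (hm (StrongDual.toWeakDual η) hη)

theorem exists_isMaxOn_weakDualBall {N : Seminorm ℝ E} {C : ℝ} (hC0 : 0 ≤ C)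
    (hC : ∀ e, N e ≤ C * ‖e‖) (S : X →L[ℝ] LInfty L) (z : InjectiveTensor X E) :
    ∃ η ∈ N.weakDualBall, ∀ t, N (tensorSliceLeft (coordFunctional S t) z) ≤
      ‖S (tensorSliceRight (WeakDual.toStrongDual η) z)‖ := by
  have hcont := continuousOn_tensorSliceRight z
    (fun η hη => Seminorm.norm_le_of_mem_weakDualBall hC0 hC hη)
  obtain ⟨η, hη, hmax⟩ := (Seminorm.isCompact_weakDualBall hC0 hC).exists_isMaxOn
    ⟨0, fun e => by
      change |(0 : ℝ)| ≤ N e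
      rw [abs_zero]
      exact apply_nonneg N e⟩ (S.continuous.comp_continuousOn hcont).norm
  exact ⟨η, hη, seminorm_tensorSliceLeft_le hC S z fun η' hη' => hmax hη'⟩

/-- The norm of `z` is controlled by its right slices, these by their images under `S`, and the
coordinates of those images by the left slices. -/
theorem norm_le_of_forall_seminorm_tensorSliceLeft_le {N : Seminorm ℝ E} {c : ℝ} (hc : 0 < c)
    (hNc : ∀ e, c * ‖e‖ ≤ N e) {S : X →L[ℝ] LInfty L} {R : ℝ} (hR : 0 ≤ R)
    (hS : ∀ x, ‖x‖ ≤ R * ‖S x‖) {z : InjectiveTensor X E} {m : ℝ} (hm0 : 0 ≤ m)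
    (hm : ∀ t, N (tensorSliceLeft (coordFunctional S t) z) ≤ m) : ‖z‖ ≤ R * c⁻¹ * m := by
  refine norm_le_of_forall_norm_tensorSliceRight_le fun η hη => (hS _).trans ?_
  rw [mul_assoc]
  refine mul_le_mul_of_nonneg_left ((LInfty.norm_le_iff (by positivity)).2 fun t => ?_) hR
  rw [← coordFunctional_apply, ← apply_tensorSliceLeft_eq, inv_mul_eq_div, le_div_iff₀' hc]
  refine le_trans (mul_le_mul_of_nonneg_left ?_ hc.le) ((hNc _).trans (hm t))
  exact (η.le_opNorm _).trans (mul_le_of_le_one_left (norm_nonneg _) hη)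

theorem hasEquivSmoothNorm_injectiveTensor {S : X →L[ℝ] LInfty L} (hS : Topology.IsEmbedding S)
    {T : X →L[ℝ] cZero L} (hST : ∀ x : X, x ≠ 0 → (S x, T x) ∈ haydonSet L) {k : ℕ∞} (hk : k ≠ 0)
    (hE : HasEquivSmoothNorm E k) : HasEquivSmoothNorm (InjectiveTensor X E) k := by
  obtain ⟨N, ⟨c, hc, C, hC0, hN⟩, hsm⟩ := hE
  obtain ⟨R, hR, hSR⟩ := exists_bound_of_isEmbedding hS
  have hC : ∀ e, N e ≤ C * ‖e‖ := fun e => (hN e).2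
  have hbound : ∀ (V : X →L[ℝ] LInfty L), ‖V‖ ≤ max ‖S‖ ‖cZeroIncl T‖ → ∀ t
      (z : InjectiveTensor X E), sliceSeminorm N (coordFunctional V t) z ≤
        C * max ‖S‖ ‖cZeroIncl T‖ * ‖z‖ := by
    intro V hV t z
    rw [mul_assoc, sliceSeminorm_apply]
    refine (hC _).trans (mul_le_mul_of_nonneg_left ?_ hC0.le)
    exact (norm_tensorSliceLeft_le _ z).trans (mul_le_mul_of_nonneg_right
      ((norm_coordFunctional_le V t).trans hV) (norm_nonneg _))
  have hcont : ∀ ξ : StrongDual ℝ X, Continuous (sliceSeminorm (E := E) N ξ) := fun ξ =>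
    (Seminorm.continuous_of_le_norm hC).comp (tensorSliceLeft ξ).continuous
  refine hasEquivSmoothNorm_of_seminorm_families (L := L) hk
    (A := fun t => sliceSeminorm N (coordFunctional S t))
    (B := fun t => sliceSeminorm N (coordFunctional (cZeroIncl T) t))
    (K := C * max ‖S‖ ‖cZeroIncl T‖) (by positivity) (hbound S (le_max_left _ _))
    (hbound (cZeroIncl T) (le_max_right _ _)) (fun t => contDiffAt_sliceSeminorm hsm _)
    (fun t => contDiffAt_sliceSeminorm hsm _) (fun t => hcont _) (fun t => hcont _)
    (tendsto_seminorm_tensorSliceLeft N hC (norm_coordFunctional_le (cZeroIncl T))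
      (tendsto_coordFunctional_cZeroIncl T))
    (R := R * c⁻¹) (by positivity)
    (fun z m hm0 hm => norm_le_of_forall_seminorm_tensorSliceLeft_le hc (fun e => (hN e).1) hR.le
      hSR hm0 hm) fun z hz => ?_
  simp only [sliceSeminorm_apply]
  obtain ⟨η, hη, hηmax⟩ := exists_isMaxOn_weakDualBall hC0.le hC S z
  obtain ⟨θ, hθ, hθmax⟩ := exists_isMaxOn_weakDualBall hC0.le hC (cZeroIncl T) z
  have hsup : ∀ ζ ∈ N.weakDualBall, tensorSliceRight (WeakDual.toStrongDual ζ) z ≠ 0 → ∀ m,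
      m ≤ max ‖S (tensorSliceRight (WeakDual.toStrongDual ζ) z)‖
        ‖T (tensorSliceRight (WeakDual.toStrongDual ζ) z)‖ →
      ∃ s, m < N (tensorSliceLeft (coordFunctional S s) z) +
        1 / 2 * N (tensorSliceLeft (coordFunctional (cZeroIncl T) s) z) := by
    intro ζ hζ h0 m hm
    obtain ⟨s, hs⟩ := exists_lt_of_mem_haydonSet (hST _ h0) hm
    refine ⟨s, hs.trans_le ?_⟩
    exact add_le_add (le_seminorm_tensorSliceLeft hζ S s z)
      (mul_le_mul_of_nonneg_left (le_seminorm_tensorSliceLeft hζ (cZeroIncl T) s z) (by norm_num))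
  have hη0 : tensorSliceRight (WeakDual.toStrongDual η) z ≠ 0 := by
    intro h0
    refine hz (norm_le_zero_iff.1 ?_)
    have := norm_le_of_forall_seminorm_tensorSliceLeft_le hc (fun e => (hN e).1) hR.le
      hSR le_rfl (fun t => (hηmax t).trans (by simp [h0]))
    simpa using this
  refine ⟨max ‖S (tensorSliceRight (WeakDual.toStrongDual η) z)‖
    ‖cZeroIncl T (tensorSliceRight (WeakDual.toStrongDual θ) z)‖, fun t =>
      ⟨(hηmax t).trans (le_max_left _ _), (hθmax t).trans (le_max_right _ _)⟩, ?_⟩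
  -- The hypothesis on `U(L)` is applied to whichever right slice realises the larger norm. If that
  -- is the slice by `θ`, it cannot vanish, since the slice by `η` would then vanish too.
  rcases le_total ‖cZeroIncl T (tensorSliceRight (WeakDual.toStrongDual θ) z)‖
    ‖S (tensorSliceRight (WeakDual.toStrongDual η) z)‖ with h | h
  · rw [max_eq_left h]
    exact hsup η hη hη0 _ (le_max_left _ _)
  · rw [max_eq_right h]
    refine hsup θ hθ (fun h0 => ?_) _ (le_max_right _ _)
    rw [h0, map_zero, norm_zero] at h
    refine hη0 (norm_le_zero_iff.1 ((hSR _).trans ?_))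
    exact mul_nonpos_of_nonneg_of_nonpos hR.le h

end Coordinates

/-! ### The two conclusions -/

theorem hasEquivSmoothNorm_of_haydonSet {X : Type*} [NormedAddCommGroup X] [NormedSpace ℝ X]
    [CompleteSpace X] {L : Type*} {S : X →L[ℝ] LInfty L} (hS : Topology.IsEmbedding S)
    {T : X →L[ℝ] cZero L} (hST : ∀ x : X, x ≠ 0 → (S x, T x) ∈ haydonSet L) :
    HasEquivSmoothNorm X ⊤ := by
  obtain ⟨R, hR, hSR⟩ := exists_bound_of_isEmbedding hS
  have habs : ContDiffOn ℝ ((⊤ : ℕ∞) : WithTop ℕ∞) (fun e : ℝ => normSeminorm ℝ ℝ e) {e | e ≠ 0} :=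
    fun e he => (contDiffAt_norm ℝ he).contDiffWithinAt
  have hbound : ∀ (V : X →L[ℝ] LInfty L), ‖V‖ ≤ max ‖S‖ ‖cZeroIncl T‖ → ∀ t x,
      ‖coordFunctional V t x‖ ≤ max ‖S‖ ‖cZeroIncl T‖ * ‖x‖ := fun V hV t x =>
    (coordFunctional V t).le_of_opNorm_le ((norm_coordFunctional_le V t).trans hV) x
  refine hasEquivSmoothNorm_of_seminorm_families (L := L) ENat.top_ne_zero
    (A := fun t => (normSeminorm ℝ ℝ).comp (coordFunctional S t : X →ₗ[ℝ] ℝ))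
    (B := fun t => (normSeminorm ℝ ℝ).comp (coordFunctional (cZeroIncl T) t : X →ₗ[ℝ] ℝ))
    (K := max ‖S‖ ‖cZeroIncl T‖) (by positivity) (hbound S (le_max_left _ _))
    (hbound (cZeroIncl T) (le_max_right _ _)) (fun t => Seminorm.contDiffAt_comp habs _)
    (fun t => Seminorm.contDiffAt_comp habs _) (fun t => (coordFunctional S t).continuous.norm)
    (fun t => (coordFunctional (cZeroIncl T) t).continuous.norm)
    (fun x => by simpa using (tendsto_coordFunctional_cZeroIncl T x).norm)
    hR (fun x m hm0 hm => (hSR x).trans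
      (mul_le_mul_of_nonneg_left ((LInfty.norm_le_iff hm0).2 hm) hR.le)) fun x hx => ?_
  exact ⟨max ‖S x‖ ‖T x‖, fun t =>
    ⟨((LInfty.norm_le_iff (norm_nonneg _)).1 le_rfl t).trans (le_max_left _ _),
      ((LInfty.norm_le_iff (f := (T x : LInfty L)) (norm_nonneg _)).1 le_rfl t).trans
        (le_max_right _ _)⟩,
    exists_lt_of_mem_haydonSet (hST x hx) le_rfl⟩

theorem hasEquivSmoothNorm_zero (X : Type*) [NormedAddCommGroup X] [NormedSpace ℝ X] :
    HasEquivSmoothNorm X 0 :=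
  ⟨normSeminorm ℝ X, ⟨1, one_pos, 1, one_pos, fun x => by simp⟩,
    contDiffOn_zero.2 continuous_norm.continuousOn⟩

theorem corollary1 {X : Type*} [NormedAddCommGroup X] [NormedSpace ℝ X] [CompleteSpace X]
    {L : Type*} (S : X →L[ℝ] LInfty L) (hS : Topology.IsEmbedding S)
    (T : X →L[ℝ] cZero L) (hST : ∀ x : X, x ≠ 0 → (S x, T x) ∈ haydonSet L) :
    HasEquivSmoothNorm X ⊤ ∧
      ∀ (k : ℕ∞) (E : Type*) [NormedAddCommGroup E] [NormedSpace ℝ E] [CompleteSpace E],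
        HasEquivSmoothNorm E k → HasEquivSmoothNorm (InjectiveTensor X E) k := by
  refine ⟨hasEquivSmoothNorm_of_haydonSet hS hST, fun k E _ _ _ hE => ?_⟩
  -- The implicit function theorem needs `k ≠ 0`; for `k = 0` the original norm already serves.
  by_cases hk : k = 0
  · subst hk
    exact hasEquivSmoothNorm_zero _
  · exact hasEquivSmoothNorm_injectiveTensor hS hST hk hE
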